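/- **Setting.** Let $q$ be a prime power with characteristic $p$, let $k,t\ge 1$ and $n$ be integers with $\frac n2\le k+t-1<n$, and put $c=n-k-t+1$, $\beta=\operatorname{lcm}(c,k)/k$, $\rho=\operatorname{lcm}(c,k)/c$. Let $\mathcal C'$ be an $[n,k]$ and $\mathcal D'$ an $[n,t]$ generalized Reed–Solomon (GRS) code over $\mathbb F_q$ such that $\mathcal S'=\mathcal C'\star\mathcal D'$ (the span of all entrywise products of codewords) is an $[n,k+t-1]$ GRS code with $\mathcal S'^{\perp}\subseteq\mathcal S'$. Let $G_{\mathcal C'},G_{\mathcal D'}$ be generator matrices of $\mathcal C',\mathcal D'$, let $H$ be a parity-check matrix of $\mathcal S'$, and write $\operatorname{diag}(G)=\begin{pmatrix}G&0\\0&G\end{pmatrix}$. Rows of $m\beta$-row matrices are indexed by $(i,b)\in[m]\times[\beta]$, columns of matrices with $2n$ columns by $(j,s)\in[2]\times[n]$. For $r\in[\rho]$, $b\in[\beta]$ let $\mathcal J_r^b\subseteq\{1,\dots,\max(c,k)\}$ be sets of size $c/\beta$ such that $\mathcal J_r^b\cap\mathcal J_r^{b'}=\emptyset$ for $b\ne b'$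 and $\mathcal J_r^b\cap\mathcal J_{r'}^{b}=\emptyset$ for $r\neq r'$; put $\mathcal J_r=\bigcup_b\mathcal J_r^b$, and let $N^{(r)}\in\mathbb F_q^{c\times n}$ be the matrix with rows the unit vectors $e_a^\top$, $a\in\mathcal J_r$. On $(\mathbb C^q)^{\otimes n}$, with orthonormal basis $|x\rangle$, $x\in\mathbb F_q^n$, let $\mathsf X(a)|x\rangle=|x+a\rangle$, $\mathsf Z(b)|x\rangle=e^{2\pi i\operatorname{tr}(b\cdot x)/p}|x\rangle$ and $\mathsf W(a,b)=\mathsf X(a)\mathsf Z(b)$, where $\operatorname{tr}$ is the trace from $\mathbb F_q$ to $\mathbb F_p$. Let $V\subseteq\mathbb F_q^{2n}$ be the row space of $\operatorname{diag}(H)$, let $\mathcal H_0$ be the space of vectors fixed by all $\mathsf W(v)$, $v\in V$, and let $\sigma_0=q^{\,n-2(k+t-1)}P_0$, with $P_0$ the orthogonal projector onto $\mathcal H_0$. **The scheme.** The servers store $m$ files; the $i$-th file $X^i$ consists of the rows $(i,b)$, $b\in[\beta]$, of a matrix $X\in\mathbb F_q^{m\beta\times 2k}$. Server $s$ stores columns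 $(1,s)$ and $(2,s)$ of $Y=X\operatorname{diag}(G_{\mathcal C'})$. The user wants the file $X^K$. In each round $r\in[\rho]$: * The $n$ servers share $n$ $q$-dimensional systems in the joint state $\sigma_0$, one system each. * The user chooses $Z^{(r)}\in\mathbb F_q^{m\beta\times 2t}$ uniformly at random, independently for different rounds, forms $Q^{(r)}=Z^{(r)}\operatorname{diag}(G_{\mathcal D'})+E_{(K)}\operatorname{diag}(N^{(r)})$, and sends columns $(1,s)$ and $(2,s)$ of $Q^{(r)}$ to server $s$. Here column $(j,a)$ of $E_{(K)}\in\mathbb F_q^{m\beta\times 2c}$, for $a\in\mathcal J_r^b$, is the unit vector at the coordinate $(K,b)$. * Server $s$ computes $A^{(r)}_{j,s}=Y_{j,s}^\top Q^{(r)}_{j,s}$ for $j=1,2$, applies $\mathsf X(A^{(r)}_{1,s})\mathsf Z(A^{(r)}_{2,s})$ to its system, and sends the system to the user. **Statement.** For every $m$ the scheme is symmetric and private against $t$ colluding servers, i.e. the following hold. 1. *User privacy.* Let $T\subseteq[n]$ with $|T|\le t$, let the stored files be arbitrary but fixed, and for each round $r$ let $U_r\subseteq[n]$ be the set of servers that have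 already applied their operators in round $r$. Then the joint classical–quantum state of all the queries received by $T$ and of the systems held by $T$, over all rounds, is the same for every index $K\in[m]$ of the desired file. 2. *Server privacy.* For every $K$ and every choice of the user's matrices $Z^{(1)},\dots,Z^{(\rho)}$, the joint state of all systems received by the user in all rounds depends on the files only through $X^K$; that is, it is the same for any two contents $X,X'$ of the storage with $X^K=X'^K$. 3. *Uniform queries.* For every $K$ and every $T\subseteq[n]$ with $|T|\le t$, the joint distribution of the queries received by the servers in $T$ over all rounds is the uniform distribution on $(\mathbb F_q^{m\beta\times 2|T|})^{\rho}$. In particular, in each round the queries to any $t$ servers are uniform on $\mathbb F_q^{m\beta\times 2t}$. -/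

import Mathlib

noncomputable section

namespace StarQPIR

/-! ### Linear codes -/

section Codes

variable {F : Type*} [Field F] {n : ℕ}

/-- `C` is an `[n,k]` generalized Reed-Solomon code: for some pairwise distinct code locators
`L i` and nonzero column multipliers `v i`, its codewords are the vectors `(v i * f (L i))_i`
with `f` a polynomial of degree less than `k`. -/
def IsGRS (k : ℕ) (C : Submodule F (Fin n → F)) : Prop :=
  k ≤ n ∧ ∃ L v : Fin n → F, Function.Injective L ∧ (∀ i, v i ≠ 0) ∧
    ∀ x : Fin n → F, x ∈ C ↔
      ∃ f : Polynomial F, f.degree < (k : WithBot ℕ) ∧ ∀ i, x i = v i * f.eval (L i)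

/-- The star product of two codes: the span of the entrywise products of their codewords. -/
def starProduct (C D : Submodule F (Fin n → F)) : Submodule F (Fin n → F) :=
  Submodule.span F {x | ∃ c ∈ C, ∃ d ∈ D, x = c * d}

/-- The Euclidean dual code. -/
def dualCode (C : Submodule F (Fin n → F)) : Submodule F (Fin n → F) where
  carrier := {x | ∀ c ∈ C, c ⬝ᵥ x = 0}
  zero_mem' := by intro c _; simp
  add_mem' := by
    intro x y hx hy c hc
    rw [dotProduct_add, hx c hc, hy c hc, add_zero]
  smul_mem' := by
    intro a x hx c hc
    rw [dotProduct_smul, hx c hc, smul_zero]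

/-- `C` is weakly self-dual if it contains its dual code. -/
def IsWeaklySelfDual (C : Submodule F (Fin n → F)) : Prop := dualCode C ≤ C

/-- The rows of `G` are a basis of the code `C`. -/
def IsGeneratorMatrix {k : ℕ} (G : Matrix (Fin k) (Fin n) F)
    (C : Submodule F (Fin n → F)) : Prop :=
  LinearIndependent F G.row ∧ Submodule.span F (Set.range G.row) = C

/-- The block diagonal matrix `diag(G, G)`; rows and columns are indexed by pairs
`(p, i)`, where `p : Fin 2` is the number of the block. -/
def diag2 {ι κ : Type*} (G : Matrix ι κ F) : Matrix (Fin 2 × ι) (Fin 2 × κ) F :=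
  Matrix.of fun r s => if r.1 = s.1 then G r.2 s.2 else 0

end Codes

/-! ### Quantum systems -/

section Quantum

/-- The tensor product of a finite family of square matrices. -/
def tensor {ι d : Type*} [Fintype ι] (M : ι → Matrix d d ℂ) : Matrix (ι → d) (ι → d) ℂ :=
  Matrix.of fun y x => ∏ i, M i (y i) (x i)

variable {F : Type*} [Field F] [Fintype F] [DecidableEq F] {n : ℕ}

/-- `ω ^ tr x`, where `ω = exp (2πi / p)`, `p` is the characteristic of `F` and `tr` is the trace
from `F` to its prime field. -/
def traceChar (x : F) : ℂ :=
  letI : Algebra (ZMod (ringChar F)) F := ZMod.algebra F (ringChar F)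
  Complex.exp (2 * Real.pi * Complex.I / (ringChar F : ℂ)) ^
    (Algebra.trace (ZMod (ringChar F)) F x).val

/-- `X(a) |x⟩ = |x + a⟩`. -/
def shiftOp (a : F) : Matrix F F ℂ :=
  Matrix.of fun y x => if y = x + a then 1 else 0

/-- `Z(b) |x⟩ = ω ^ tr (b x) |x⟩`. -/
def phaseOp (b : F) : Matrix F F ℂ :=
  Matrix.diagonal fun x => traceChar (b * x)

/-- The Weyl operator `W(a, b) = X(a) Z(b)` on `n` systems of dimension `q`, where
`a = (v (0, s))_s` and `b = (v (1, s))_s`. -/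
def weyl (v : Fin 2 × Fin n → F) : Matrix (Fin n → F) (Fin n → F) ℂ :=
  tensor (fun s => shiftOp (v (0, s))) * tensor (fun s => phaseOp (v (1, s)))

/-- `(a, b) J (c, d)ᵀ` for `J = [[0, -I], [I, 0]]`, that is `b · c - a · d`. -/
def sympForm (v w : Fin 2 × Fin n → F) : F :=
  ∑ s, (v (1, s) * w (0, s) - v (0, s) * w (1, s))

/-- The common eigenspace `H_w` of the Weyl operators `W(v)`, `v ∈ V`, for the eigenvalues
`ω ^ tr (v J wᵀ)`. -/
def eigenspace (V : Submodule F (Fin 2 × Fin n → F)) (w : Fin 2 × Fin n → F) :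
    Submodule ℂ (EuclideanSpace ℂ (Fin n → F)) :=
  ⨅ v ∈ V, Module.End.eigenspace (Matrix.toEuclideanLin (weyl v)) (traceChar (sympForm v w))

/-- The matrix of the orthogonal projection onto `H_w`. -/
def eigenProj (V : Submodule F (Fin 2 × Fin n → F)) (w : Fin 2 × Fin n → F) :
    Matrix (Fin n → F) (Fin n → F) ℂ :=
  Matrix.toEuclideanLin.symm ((eigenspace V w).starProjection :
    EuclideanSpace ℂ (Fin n → F) →ₗ[ℂ] EuclideanSpace ℂ (Fin n → F))

/-- Combine basis labels of the systems in `T` and of the systems outside `T`. -/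
def glue {T : Finset (Fin n)} (y : T → F) (z : {s : Fin n // s ∉ T} → F) : Fin n → F :=
  fun s => if h : s ∈ T then y ⟨s, h⟩ else z ⟨s, h⟩

/-- The reduced state on the systems in `T` (partial trace over the systems outside `T`). -/
def reducedState (T : Finset (Fin n)) (ρ : Matrix (Fin n → F) (Fin n → F) ℂ) :
    Matrix (T → F) (T → F) ℂ :=
  Matrix.of fun y x => ∑ z : {s : Fin n // s ∉ T} → F, ρ (glue y z) (glue x z)

end Quantum

/-! ### The scheme -/

/-- The number `c = n - k - t + 1`. -/
def cParam (n k t : ℕ) : ℕ := n - k - t + 1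

/-- The number of rows per file, `β = lcm(c, k) / k`. -/
def betaParam (n k t : ℕ) : ℕ := Nat.lcm (cParam n k t) k / k

/-- The number of rounds, `lcm(c, k) / c`. -/
def roundsParam (n k t : ℕ) : ℕ := Nat.lcm (cParam n k t) k / cParam n k t

/-- The sets of servers that are targeted in the round `r` for the row `b` of the desired file:
each is a set of `c / β` of the first `max(c, k)` servers, those of one round are disjoint, and
those of different rounds for the same row are disjoint. -/
structure IsTargetFamily (n k t : ℕ)
    (J : Fin (roundsParam n k t) → Fin (betaParam n k t) → Finset (Fin n)) : Prop where
  card_eq : ∀ r b, (J r b).card = cParam n k t / betaParam n k t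
  lt_max : ∀ r b, ∀ s ∈ J r b, (s : ℕ) < max (cParam n k t) k
  disjoint_row : ∀ r b b', b ≠ b' → Disjoint (J r b) (J r b')
  disjoint_round : ∀ r r' b, r ≠ r' → Disjoint (J r b) (J r' b)

/-- The choices that enter the coded QPIR scheme with parameters `n`, `k`, `t` over `F`. -/
structure Scheme (F : Type*) [Field F] (n k t : ℕ) where
  one_le_k : 1 ≤ k
  one_le_t : 1 ≤ t
  half_le : n ≤ 2 * (k + t - 1)
  lt_n : k + t - 1 < n
  /-- the storage code -/
  C : Submodule F (Fin n → F)
  /-- the query code -/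
  D : Submodule F (Fin n → F)
  C_grs : IsGRS k C
  D_grs : IsGRS t D
  star_grs : IsGRS (k + t - 1) (starProduct C D)
  star_weaklySelfDual : IsWeaklySelfDual (starProduct C D)
  /-- generator matrix of the storage code -/
  GC : Matrix (Fin k) (Fin n) F
  /-- generator matrix of the query code -/
  GD : Matrix (Fin t) (Fin n) F
  /-- parity-check matrix of the star product code -/
  HS : Matrix (Fin (n - k - t + 1)) (Fin n) F
  GC_gen : IsGeneratorMatrix GC C
  GD_gen : IsGeneratorMatrix GD D
  HS_gen : IsGeneratorMatrix HS (dualCode (starProduct C D))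
  /-- targeted servers -/
  J : Fin (roundsParam n k t) → Fin (betaParam n k t) → Finset (Fin n)
  J_target : IsTargetFamily n k t J

/-- The content `X` of the storage: row `(i, b)` is the `b`-th row of the file `i`. -/
abbrev Files (F : Type*) (n k t m : ℕ) : Type _ :=
  Matrix (Fin m × Fin (betaParam n k t)) (Fin 2 × Fin k) F

/-- The user's random matrices `Z`, one for each round. -/
abbrev Masks (F : Type*) (n k t m : ℕ) : Type _ :=
  Fin (roundsParam n k t) → Matrix (Fin m × Fin (betaParam n k t)) (Fin 2 × Fin t) F

/-- The queries received by the servers in `T` in all rounds: `m β × 2 |T|` matrices. -/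
abbrev QueriesTo (F : Type*) (n k t m : ℕ) (T : Finset (Fin n)) : Type _ :=
  Fin (roundsParam n k t) → Matrix (Fin m × Fin (betaParam n k t)) (Fin 2 × T) F

namespace Scheme

variable {F : Type*} [Field F] {n k t m : ℕ}

/-- The stored matrix `Y = X · diag(G_C, G_C)`. Server `s` stores the columns `(0, s)` and
`(1, s)`. -/
def encoded (S : Scheme F n k t) (X : Files F n k t m) :
    Matrix (Fin m × Fin (betaParam n k t)) (Fin 2 × Fin n) F :=
  X * diag2 S.GC

/-- The matrix `N` of the round `r`, whose rows are the unit vectors `e_a` for the targeted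
servers `a`. -/
def unitRows (S : Scheme F n k t) (r : Fin (roundsParam n k t)) :
    Matrix (Σ b : Fin (betaParam n k t), S.J r b) (Fin n) F :=
  Matrix.of fun a s => if (a.2 : Fin n) = s then 1 else 0

/-- The matrix `E_(K)`: the column `(p, a)`, for a server `a` that is targeted for the row `b`,
is the unit vector of the coordinate `(K, b)`. -/
def fileSelector (S : Scheme F n k t) (K : Fin m) (r : Fin (roundsParam n k t)) :
    Matrix (Fin m × Fin (betaParam n k t))
      (Fin 2 × (Σ b : Fin (betaParam n k t), S.J r b)) F :=
  Matrix.of fun ib pa => if ib = (K, pa.2.1) then 1 else 0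

/-- The queries `Q = Z · diag(G_D, G_D) + E_(K) · diag(N, N)` of the round `r`. Server `s`
receives the columns `(0, s)` and `(1, s)`. -/
def query (S : Scheme F n k t) (K : Fin m) (Z : Masks F n k t m)
    (r : Fin (roundsParam n k t)) :
    Matrix (Fin m × Fin (betaParam n k t)) (Fin 2 × Fin n) F :=
  Z r * diag2 S.GD + S.fileSelector K r * diag2 (S.unitRows r)

/-- The queries that the servers in `T` receive in all rounds. -/
def queriesTo (S : Scheme F n k t) (T : Finset (Fin n)) (K : Fin m) (Z : Masks F n k t m) :
    QueriesTo F n k t m T :=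
  fun r => (S.query K Z r).submatrix id (fun ps => (ps.1, (ps.2 : Fin n)))

/-- The responses `A_{p,s} = Y_{p,s} · Q_{p,s}` of the round `r`. -/
def response (S : Scheme F n k t) (K : Fin m) (X : Files F n k t m) (Z : Masks F n k t m)
    (r : Fin (roundsParam n k t)) : Fin 2 × Fin n → F :=
  fun ps => (S.encoded X).col ps ⬝ᵥ (S.query K Z r).col ps

/-- The space `V`, spanned by the rows of `diag(H, H)`. -/
def stabilizerSpace (S : Scheme F n k t) : Submodule F (Fin 2 × Fin n → F) :=
  Submodule.span F (Set.range (diag2 S.HS).row)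

variable [Fintype F] [DecidableEq F]

/-- The initial state of the `n` systems in each round, `|0̄⟩⟨0̄| ⊗ σ_mix`: the maximally mixed
state of the eigenspace `H_0`, which has dimension `q ^ (2 (k + t - 1) - n)`. -/
def initialState (S : Scheme F n k t) : Matrix (Fin n → F) (Fin n → F) ℂ :=
  ((Fintype.card F : ℂ) ^ (2 * (k + t - 1) - n))⁻¹ • eigenProj S.stabilizerSpace 0

/-- The state of the `n` systems in the round `r` when exactly the servers `s ∈ U` have applied
their operators `X(A_{1,s}) Z(A_{2,s})`. -/
def roundState (S : Scheme F n k t) (U : Finset (Fin n)) (K : Fin m) (X : Files F n k t m)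
    (Z : Masks F n k t m) (r : Fin (roundsParam n k t)) :
    Matrix (Fin n → F) (Fin n → F) ℂ :=
  let W := weyl fun ps => if ps.2 ∈ U then S.response K X Z r ps else 0
  W * S.initialState * W.conjTranspose

/-- The state of all the systems that the user receives in all rounds, given his random
matrices `Z`. -/
def receivedState (S : Scheme F n k t) (K : Fin m) (X : Files F n k t m)
    (Z : Masks F n k t m) :
    Matrix (Fin (roundsParam n k t) → (Fin n → F)) (Fin (roundsParam n k t) → (Fin n → F)) ℂ :=
  tensor fun r => S.roundState Finset.univ K X Z r

/-- The joint distribution of the queries that the servers in `T` receive in all rounds, when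
the file `K` is desired and the matrices `Z` are independent and uniform. -/
def queryLaw (S : Scheme F n k t) (T : Finset (Fin n)) (K : Fin m) :
    PMF (QueriesTo F n k t m T) :=
  (PMF.uniformOfFintype (Masks F n k t m)).map (S.queriesTo T K)

/-- The classical-quantum state that the servers in `T` hold, given the stored files, at the stage
where in the round `r` the servers in `U r` have applied their operators. Its classical register
contains the queries to `T` in all rounds, its quantum register the systems of `T` in all rounds;
the value at `Q` is the (unnormalized) state of the quantum register when the queries are `Q`. -/
def serverView (S : Scheme F n k t) (T : Finset (Fin n))
    (U : Fin (roundsParam n k t) → Finset (Fin n)) (K : Fin m) (X : Files F n k t m)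
    (Q : QueriesTo F n k t m T) :
    Matrix (Fin (roundsParam n k t) → (T → F)) (Fin (roundsParam n k t) → (T → F)) ℂ :=
  ∑ Z : Masks F n k t m,
    if S.queriesTo T K Z = Q then
      ((Fintype.card (Masks F n k t m) : ℂ))⁻¹ •
        tensor fun r => reducedState T (S.roundState (U r) K X Z r)
    else 0

/-- User privacy: whatever the stored files are, and at every stage of the protocol, the joint
classical-quantum state of any at most `t` servers does not depend on the index of the desired
file. -/
def UserPrivate (S : Scheme F n k t) (m : ℕ) : Prop :=
  ∀ T : Finset (Fin n), T.card ≤ t →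
    ∀ (U : Fin (roundsParam n k t) → Finset (Fin n)) (X : Files F n k t m) (K K' : Fin m),
      S.serverView T U K X = S.serverView T U K' X

/-- Server privacy: given the user's index `K` and his random matrices `Z`, the state that he
receives depends on the file `K` only. -/
def ServerPrivate (S : Scheme F n k t) (m : ℕ) : Prop :=
  ∀ (K : Fin m) (Z : Masks F n k t m) (X X' : Files F n k t m),
    (∀ b ps, X (K, b) ps = X' (K, b) ps) → S.receivedState K X Z = S.receivedState K X' Z

/-- A scheme with user and server privacy is called symmetric. -/
def Symmetric (S : Scheme F n k t) (m : ℕ) : Prop :=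
  S.UserPrivate m ∧ S.ServerPrivate m

end Scheme

/-! ### The standard family of targeted servers -/

/-- The first `max(c, k)` servers are divided into `max(β, rounds)` consecutive blocks of length
`c / β`; in the round `r`, the block `b + r` (cyclically) is used for the row `b`. -/
def cyclicTargets (n k t : ℕ) (r : Fin (roundsParam n k t)) (b : Fin (betaParam n k t)) :
    Finset (Fin n) :=
  Finset.univ.filter fun s : Fin n =>
    (s : ℕ) / (cParam n k t / betaParam n k t) =
      ((b : ℕ) + r) % max (betaParam n k t) (roundsParam n k t)

theorem cyclicTargets_isTargetFamily {n k t : ℕ} (hk : 1 ≤ k) (ht : 1 ≤ t)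
    (hn : k + t - 1 < n) : IsTargetFamily n k t (cyclicTargets n k t) := by
  have hc : 1 ≤ cParam n k t := by unfold cParam; omega
  have hcn : max (cParam n k t) k ≤ n := by unfold cParam; omega
  obtain ⟨g, x, y, hg, hxy, hcx, hky⟩ :
      ∃ g x y, 0 < g ∧ Nat.Coprime x y ∧ cParam n k t = x * g ∧ k = y * g := by
    obtain ⟨x, y, h1, h2, h3⟩ := Nat.exists_coprime (cParam n k t) k
    exact ⟨_, x, y, Nat.gcd_pos_of_pos_left _ hc, h1, h2, h3⟩
  have hx : 0 < x := Nat.pos_of_ne_zero (by rintro rfl; simp at hcx; omega)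
  have hy : 0 < y := Nat.pos_of_ne_zero (by rintro rfl; simp at hky; omega)
  have hl : Nat.lcm (cParam n k t) k = x * y * g := by
    conv_lhs => rw [hcx, hky]
    rw [Nat.lcm_mul_right, hxy.lcm_eq_mul]
  have hb : betaParam n k t = x := by
    unfold betaParam
    rw [hl]
    exact Nat.div_eq_of_eq_mul_left hk (by rw [hky]; ring)
  have hr : roundsParam n k t = y := by
    unfold roundsParam
    rw [hl]
    exact Nat.div_eq_of_eq_mul_left hc (by rw [hcx]; ring)
  have hgg : cParam n k t / betaParam n k t = g := by
    rw [hb, hcx]; exact Nat.mul_div_cancel_left g hx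
  have hL : max x y * g = max (cParam n k t) k := by
    rw [hcx]
    conv_rhs => rw [hky]
    rcases le_total x y with h | h
    · rw [max_eq_right h, max_eq_right (Nat.mul_le_mul_right g h)]
    · rw [max_eq_left h, max_eq_left (Nat.mul_le_mul_right g h)]
  have hmem : ∀ r b (s : Fin n), s ∈ cyclicTargets n k t r b ↔
      (s : ℕ) / g = ((b : ℕ) + r) % max x y := by
    intro r b s
    rw [cyclicTargets, Finset.mem_filter, hgg]
    simp [hb, hr]
  have hinj : ∀ a a' d : ℕ, a < max x y → a' < max x y →
      (a + d) % max x y = (a' + d) % max x y → a = a' := by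
    intro a a' d h h' e
    have := Nat.ModEq.add_right_cancel' d (show a + d ≡ a' + d [MOD max x y] from e)
    exact Nat.ModEq.eq_of_lt_of_lt this h h'
  refine ⟨?_, ?_, ?_, ?_⟩
  · intro r b
    rw [hgg]
    set e := ((b : ℕ) + r) % max x y with he
    have hlt : e < max x y := Nat.mod_lt _ (lt_max_of_lt_left hx)
    have hle : (e + 1) * g ≤ n := (Nat.mul_le_mul_right g hlt).trans (hL.le.trans hcn)
    have hmap : (cyclicTargets n k t r b).map Fin.valEmbedding =
        Finset.Ico (e * g) ((e + 1) * g) := by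
      ext s
      simp only [Finset.mem_map, hmem, Finset.mem_Ico, Fin.valEmbedding_apply]
      constructor
      · rintro ⟨s, hs, rfl⟩
        have h' : (s : ℕ) / g = e := hs
        exact ⟨h' ▸ Nat.div_mul_le_self _ _,
          (Nat.div_lt_iff_lt_mul hg).mp (h' ▸ Nat.lt_succ_self _)⟩
      · rintro ⟨h1, h2⟩
        refine ⟨⟨s, h2.trans_le hle⟩, ?_, rfl⟩
        exact Nat.div_eq_of_lt_le h1 h2
    rw [← Finset.card_map, hmap, Nat.card_Ico, Nat.add_mul]
    omega
  · intro r b s hs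
    rw [hmem] at hs
    rw [← hL, ← Nat.div_lt_iff_lt_mul hg, hs]
    exact Nat.mod_lt _ (lt_max_of_lt_left hx)
  · intro r b b' hbb
    rw [Finset.disjoint_left]
    intro s h h'
    rw [hmem] at h h'
    refine hbb (Fin.ext (hinj b b' r ?_ ?_ (h.symm.trans h')))
    · exact lt_max_of_lt_left (hb ▸ b.2)
    · exact lt_max_of_lt_left (hb ▸ b'.2)
  · intro r r' b hrr
    rw [Finset.disjoint_left]
    intro s h h'
    rw [hmem] at h h'
    refine hrr (Fin.ext (hinj r r' b ?_ ?_ ?_))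
    · exact lt_max_of_lt_right (hr ▸ r.2)
    · exact lt_max_of_lt_right (hr ▸ r'.2)
    · rw [add_comm, add_comm (r' : ℕ)]
      exact h.symm.trans h'

end StarQPIR

end

/-! Conjugation by Weyl operators is insensitive to phases, hence additive in the label
(`conj_weyl_add`); both privacy proofs split a label in two and discard one part.

Servers `T`: a GRS code of dimension `t` takes arbitrary values on any `t` coordinates, so a
translation of the masks turns the queries to `T` for one file into those for another, or into any
prescribed ones (`exists_mask_translate`). Translations preserve the uniform law, which gives
uniform queries. The queries to `T` determine the responses of `T`, and operators outside `T` vanish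
under the partial trace (`reducedState_conj_weyl_congr`), so the joint states agree as well.

User: the selector vanishes on the rows of the undesired files, so changing these files alters each
half of the response by an element of the star product (`response_sub_mem`). Such a label is
symplectically orthogonal to the stabilizer, whose halves lie in the dual code; its Weyl operator
therefore commutes with the projection onto `H_0` and leaves the state unchanged
(`conj_weyl_eigenProj`). -/

namespace StarQPIR

/-! ### Weyl operators, partial traces and stabilizer projections. -/

section Weyl

variable {F : Type*} [Field F] [Fintype F] {n : ℕ}

theorem traceChar_zero {F : Type*} [Field F] : traceChar (0 : F) = 1 := by
  simp [traceChar]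

theorem traceChar_add (x y : F) : traceChar (x + y) = traceChar x * traceChar y := by
  let _ : Algebra (ZMod (ringChar F)) F := ZMod.algebra F (ringChar F)
  have hp : ringChar F ≠ 0 := CharP.ringChar_ne_zero_of_finite F
  have : NeZero (ringChar F) := ⟨hp⟩
  have hroot : Complex.exp (2 * Real.pi * Complex.I / (ringChar F : ℂ)) ^ ringChar F = 1 :=
    (Complex.isPrimitiveRoot_exp _ hp).pow_eq_one
  simp only [traceChar]
  -- `ZMod.val` is additive only modulo `p`, which suffices for powers of a `p`-th root of unity.
  rw [map_add, ZMod.val_add, ← pow_add]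
  exact (pow_eq_pow_mod _ hroot).symm

theorem norm_traceChar (x : F) : ‖traceChar x‖ = 1 := by
  have hp : ringChar F ≠ 0 := CharP.ringChar_ne_zero_of_finite F
  rw [traceChar, norm_pow, (Complex.isPrimitiveRoot_exp _ hp).norm'_eq_one hp, one_pow]

theorem traceChar_mul_star (x : F) : traceChar x * star (traceChar x) = 1 := by
  rw [Complex.star_def, Complex.mul_conj, Complex.normSq_eq_norm_sq, norm_traceChar]
  simp

theorem traceChar_sum {ι : Type*} (s : Finset ι) (f : ι → F) :
    traceChar (∑ i ∈ s, f i) = ∏ i ∈ s, traceChar (f i) := by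
  classical
  induction s using Finset.induction_on with
  | empty => simp [traceChar_zero]
  | insert a s ha ih => rw [Finset.sum_insert ha, Finset.prod_insert ha, traceChar_add, ih]

variable [DecidableEq F]

theorem weyl_apply (v : Fin 2 × Fin n → F) (y x : Fin n → F) :
    weyl v y x = if y = x + (fun s => v (0, s)) then traceChar (∑ s, v (1, s) * x s) else 0 := by
  have hX : ∀ z : Fin n → F, tensor (fun s => shiftOp (v (0, s))) y z =
      if y = z + (fun s => v (0, s)) then 1 else 0 := by
    intro z
    simp only [tensor, shiftOp, Matrix.of_apply]
    rw [Finset.prod_ite_zero]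
    simp [funext_iff]
  have hZ : ∀ z : Fin n → F, tensor (fun s => phaseOp (v (1, s))) z x =
      if z = x then traceChar (∑ s, v (1, s) * x s) else 0 := by
    intro z
    simp only [tensor, phaseOp, Matrix.of_apply, Matrix.diagonal_apply]
    rw [Finset.prod_ite_zero, traceChar_sum]
    by_cases h : z = x
    · subst h; simp
    · rw [if_neg h, if_neg]
      simpa [funext_iff] using h
  rw [weyl, Matrix.mul_apply]
  simp [hX, hZ]

theorem weyl_mul (v w : Fin 2 × Fin n → F) :
    weyl v * weyl w = traceChar (∑ s, v (1, s) * w (0, s)) • weyl (v + w) := by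
  ext y x
  rw [Matrix.mul_apply, Matrix.smul_apply, weyl_apply]
  simp only [weyl_apply v, weyl_apply w, mul_ite, mul_zero, Finset.sum_ite_eq',
    Finset.mem_univ, if_true]
  have h1 : (x + fun s => w (0, s)) + (fun s => v (0, s)) = x + fun s => (v + w) (0, s) := by
    ext s; simp; ring
  rw [h1]
  split_ifs
  · rw [smul_eq_mul, ← traceChar_add, ← traceChar_add, ← Finset.sum_add_distrib,
      ← Finset.sum_add_distrib]
    congr 1
    refine Finset.sum_congr rfl fun s _ => ?_
    simp only [Pi.add_apply]
    ring
  · simp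

theorem weyl_mul_apply (v : Fin 2 × Fin n → F) (M : Matrix (Fin n → F) (Fin n → F) ℂ)
    (y x : Fin n → F) :
    (weyl v * M) y x = traceChar (∑ s, v (1, s) * (y s - v (0, s))) *
      M (y - fun s => v (0, s)) x := by
  rw [Matrix.mul_apply, Finset.sum_eq_single (y - fun s => v (0, s))]
  · rw [weyl_apply, if_pos (by simp)]; rfl
  · intro z _ hz
    rw [weyl_apply, if_neg, zero_mul]
    rintro rfl
    simp at hz
  · simp

theorem conj_weyl_apply (v : Fin 2 × Fin n → F) (M : Matrix (Fin n → F) (Fin n → F) ℂ)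
    (y x : Fin n → F) :
    (weyl v * M * (weyl v).conjTranspose) y x =
      traceChar (∑ s, v (1, s) * (y s - v (0, s))) *
        star (traceChar (∑ s, v (1, s) * (x s - v (0, s)))) *
        M (y - fun s => v (0, s)) (x - fun s => v (0, s)) := by
  have h : (weyl v * M * (weyl v).conjTranspose) =
      weyl v * (weyl v * M.conjTranspose).conjTranspose := by
    rw [Matrix.conjTranspose_mul, Matrix.conjTranspose_conjTranspose, Matrix.mul_assoc]
  rw [h, weyl_mul_apply, Matrix.conjTranspose_apply, weyl_mul_apply, star_mul',
    Matrix.conjTranspose_apply, star_star, mul_assoc]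

theorem weyl_mul_conjTranspose (v : Fin 2 × Fin n → F) :
    weyl v * (weyl v).conjTranspose = 1 := by
  ext y x
  have h := conj_weyl_apply v 1 y x
  rw [Matrix.mul_one] at h
  rw [h, Matrix.one_apply, Matrix.one_apply]
  by_cases hyx : y = x
  · subst hyx; rw [traceChar_mul_star, if_pos rfl, if_pos rfl, mul_one]
  · simp [hyx]

/-- Conjugation by Weyl operators is multiplicative, since the phases cancel. -/
theorem conj_weyl_add (v w : Fin 2 × Fin n → F) (M : Matrix (Fin n → F) (Fin n → F) ℂ) :
    weyl (v + w) * M * (weyl (v + w)).conjTranspose =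
      weyl v * (weyl w * M * (weyl w).conjTranspose) * (weyl v).conjTranspose := by
  have h : weyl v * (weyl w * M * (weyl w).conjTranspose) * (weyl v).conjTranspose =
      (weyl v * weyl w) * M * (weyl v * weyl w).conjTranspose := by
    rw [Matrix.conjTranspose_mul]; simp only [Matrix.mul_assoc]
  rw [h, weyl_mul, Matrix.conjTranspose_smul]
  simp only [Matrix.smul_mul, Matrix.mul_smul, smul_smul]
  rw [mul_comm, traceChar_mul_star, one_smul]

/-- `W(-v) W(v)` is a scalar phase and `W(v)` is unitary. Only the label `-v` matters later: it
shows that adjoints preserve the same eigenspaces. -/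
theorem weyl_conjTranspose (v : Fin 2 × Fin n → F) :
    ∃ c : ℂ, (weyl v).conjTranspose = c • weyl (-v) := by
  have h0 : weyl (0 : Fin 2 × Fin n → F) = 1 := by
    ext y x; simp [weyl_apply, Matrix.one_apply, traceChar_zero, ← Pi.zero_def]
  have h := weyl_mul (-v) v
  rw [neg_add_cancel, h0] at h
  set c := traceChar (∑ s, (-v) (1, s) * v (0, s)) with hc
  refine ⟨star c, ?_⟩
  have h2 : (weyl v).conjTranspose = (star c * c) • (weyl v).conjTranspose := by
    rw [mul_comm, hc, traceChar_mul_star, one_smul]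
  rw [h2, mul_smul]
  congr 1
  rw [← Matrix.one_mul (weyl v).conjTranspose, ← Matrix.smul_mul, ← h, Matrix.mul_assoc,
    weyl_mul_conjTranspose, Matrix.mul_one]

/-- Operators on the systems outside `T` do not change the reduced state on `T`. -/
theorem reducedState_conj_weyl_of_vanish (T : Finset (Fin n)) (d : Fin 2 × Fin n → F)
    (hd : ∀ p, ∀ s ∈ T, d (p, s) = 0) (M : Matrix (Fin n → F) (Fin n → F) ℂ) :
    reducedState T (weyl d * M * (weyl d).conjTranspose) = reducedState T M := by
  have hglue : ∀ (y : T → F) (z : {s : Fin n // s ∉ T} → F),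
      glue y z - (fun s => d (0, s)) = glue y (z - fun s : {s : Fin n // s ∉ T} => d (0, s.1)) := by
    intro y z
    ext s
    by_cases hs : s ∈ T <;> simp [glue, hs, hd]
  -- Only coordinates outside `T` contribute to the phase, and there the row and column indices
  -- share the label `z`; the two phases thus cancel.
  have hphase : ∀ (y x : T → F) (z : {s : Fin n // s ∉ T} → F),
      ∑ s, d (1, s) * (glue y z s - d (0, s)) = ∑ s, d (1, s) * (glue x z s - d (0, s)) := by
    intro y x z
    refine Finset.sum_congr rfl fun s _ => ?_
    by_cases hs : s ∈ T <;> simp [glue, hs, hd]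
  ext y x
  simp only [reducedState, Matrix.of_apply]
  refine Fintype.sum_equiv (Equiv.subRight fun s : {s : Fin n // s ∉ T} => d (0, s.1)) _ _ fun z => ?_
  rw [conj_weyl_apply, hphase y x z, traceChar_mul_star, one_mul, hglue, hglue]
  rfl

/-- The reduced state on `T` depends only on the operators applied in `T`. -/
theorem reducedState_conj_weyl_congr (T : Finset (Fin n)) (v w : Fin 2 × Fin n → F)
    (h : ∀ p, ∀ s ∈ T, v (p, s) = w (p, s)) (M : Matrix (Fin n → F) (Fin n → F) ℂ) :
    reducedState T (weyl v * M * (weyl v).conjTranspose) =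
      reducedState T (weyl w * M * (weyl w).conjTranspose) := by
  -- The part `v - w` vanishes on `T`; written first, it becomes the outer conjugation.
  have hv : v = (v - w) + w := by abel
  rw [hv, conj_weyl_add, reducedState_conj_weyl_of_vanish]
  intro p s hs
  simp [h p s hs]

/-- Both products are phases times `W(v + w)`, and the exponents of the phases differ by `sympForm v
w`. -/
theorem weyl_comm {v w : Fin 2 × Fin n → F} (h : sympForm v w = 0) :
    weyl v * weyl w = weyl w * weyl v := by
  have h' : ∑ s, v (1, s) * w (0, s) = ∑ s, w (1, s) * v (0, s) := by
    rw [← sub_eq_zero, ← Finset.sum_sub_distrib, ← h, sympForm]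
    exact Finset.sum_congr rfl fun s _ => by ring
  rw [weyl_mul, weyl_mul, h', add_comm]

theorem sympForm_neg {F : Type*} [Field F] (v w : Fin 2 × Fin n → F) :
    sympForm v (-w) = -sympForm v w := by
  rw [sympForm, sympForm, ← Finset.sum_neg_distrib]
  exact Finset.sum_congr rfl fun s _ => by simp only [Pi.neg_apply]; ring

theorem weyl_mem_eigenspace {V : Submodule F (Fin 2 × Fin n → F)} {d w : Fin 2 × Fin n → F}
    (hd : ∀ v ∈ V, sympForm v d = 0) {x : EuclideanSpace ℂ (Fin n → F)}
    (hx : x ∈ eigenspace V w) :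
    Matrix.toEuclideanLin (weyl d) x ∈ eigenspace V w := by
  simp only [eigenspace, Submodule.mem_iInf, Module.End.mem_eigenspace_iff] at hx ⊢
  intro v hv
  have hcomm : Matrix.toEuclideanLin (weyl v) (Matrix.toEuclideanLin (weyl d) x) =
      Matrix.toEuclideanLin (weyl d) (Matrix.toEuclideanLin (weyl v) x) := by
    simp only [Matrix.toLpLin_apply, Matrix.mulVec_mulVec, weyl_comm (hd v hv)]
  rw [hcomm, hx v hv, map_smul]

/-- Weyl operators that commute with the stabilizer fix its eigenprojections. -/
theorem conj_weyl_eigenProj {V : Submodule F (Fin 2 × Fin n → F)} {d : Fin 2 × Fin n → F}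
    (hd : ∀ v ∈ V, sympForm v d = 0) (w : Fin 2 × Fin n → F) :
    weyl d * eigenProj V w * (weyl d).conjTranspose = eigenProj V w := by
  have hcomm : weyl d * eigenProj V w = eigenProj V w * weyl d := by
    apply Matrix.toEuclideanLin.injective
    refine LinearMap.ext fun x => ?_
    have hmul : ∀ A B : Matrix (Fin n → F) (Fin n → F) ℂ, Matrix.toEuclideanLin (A * B) x =
        Matrix.toEuclideanLin A (Matrix.toEuclideanLin B x) := by
      intro A B
      simp only [Matrix.toLpLin_apply, Matrix.mulVec_mulVec]
    have hP : ∀ y, Matrix.toEuclideanLin (eigenProj V w) y =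
        (eigenspace V w).starProjection y := by
      intro y
      rw [eigenProj, LinearEquiv.apply_symm_apply]
      rfl
    rw [hmul, hmul, hP, hP]
    -- It remains to see that `W(d)` maps `x - Px` into the orthogonal complement of the eigenspace.
    -- The adjoint, a multiple of `W(-d)`, preserves the eigenspace, so it can be moved to the other
    -- argument.
    refine (Submodule.eq_starProjection_of_mem_of_inner_eq_zero
      (weyl_mem_eigenspace hd (Submodule.starProjection_apply_mem _ x)) fun h hh => ?_).symm
    rw [← map_sub, ← LinearMap.adjoint_inner_right, ← Matrix.toEuclideanLin_conjTranspose_eq_adjoint]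
    obtain ⟨c, hc⟩ := weyl_conjTranspose d
    rw [hc, map_smul, LinearMap.smul_apply, inner_smul_right]
    have hmem := weyl_mem_eigenspace (d := -d) (fun v hv => by
      rw [sympForm_neg, hd v hv, neg_zero]) hh
    rw [Submodule.starProjection_inner_eq_zero x _ hmem, mul_zero]
  rw [hcomm, Matrix.mul_assoc, weyl_mul_conjTranspose, Matrix.mul_one]

end Weyl

/-! ### Interpolation and generator matrices. -/

section Codes

variable {F : Type*} [Field F] {n k : ℕ}

/-- A GRS code of dimension `k` takes arbitrary values on any `k` coordinates. -/
theorem IsGRS.exists_mem_eq_on {C : Submodule F (Fin n → F)} (hC : IsGRS k C)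
    {T : Finset (Fin n)} (hT : T.card ≤ k) (y : Fin n → F) :
    ∃ x ∈ C, ∀ s ∈ T, x s = y s := by
  obtain ⟨-, L, v, hL, hv, hmem⟩ := hC
  -- Dividing by `v i` compensates the column multipliers.
  let f := Lagrange.interpolate T L fun i => y i / v i
  refine ⟨fun i => v i * f.eval (L i), (hmem _).2 ⟨f, ?_, fun _ => rfl⟩, fun s hs => ?_⟩
  · exact (Lagrange.degree_interpolate_lt _ hL.injOn).trans_le (by exact_mod_cast hT)
  · simp only [f]
    rw [Lagrange.eval_interpolate_at_node _ hL.injOn hs, mul_div_cancel₀ _ (hv s)]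

theorem IsGeneratorMatrix.exists_vecMul {G : Matrix (Fin k) (Fin n) F}
    {C : Submodule F (Fin n → F)} (hG : IsGeneratorMatrix G C) {x : Fin n → F} (hx : x ∈ C) :
    ∃ u, Matrix.vecMul u G = x := by
  rw [← hG.2, Submodule.mem_span_range_iff_exists_fun] at hx
  obtain ⟨u, hu⟩ := hx
  refine ⟨u, ?_⟩
  rw [← hu, Matrix.vecMul_eq_sum]
  rfl

theorem IsGeneratorMatrix.vecMul_mem {G : Matrix (Fin k) (Fin n) F}
    {C : Submodule F (Fin n → F)} (hG : IsGeneratorMatrix G C) (u : Fin k → F) :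
    Matrix.vecMul u G ∈ C := by
  rw [← hG.2, Matrix.vecMul_eq_sum]
  exact Submodule.sum_mem _ fun i _ =>
    Submodule.smul_mem _ _ (Submodule.subset_span ⟨i, rfl⟩)

theorem mul_diag2_apply {ι ι' κ : Type*} [Fintype ι] (M : Matrix ι' (Fin 2 × ι) F)
    (G : Matrix ι κ F) (a : ι') (p : Fin 2) (s : κ) :
    (M * diag2 G) a (p, s) = Matrix.vecMul (fun i => M a (p, i)) G s := by
  simp only [Matrix.mul_apply, diag2, Matrix.of_apply, Fintype.sum_prod_type, Matrix.vecMul,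
    dotProduct, mul_ite, mul_zero]
  rw [Finset.sum_comm]
  simp

end Codes

/-! ### Masks, responses and the stabilizer of the scheme. -/

namespace Scheme

variable {F : Type*} [Field F] {n k t m : ℕ} (S : Scheme F n k t)

/-- The queries are affine in the masks, with a linear part independent of `K`. -/
theorem queriesTo_add (T : Finset (Fin n)) (K : Fin m) (Z d : Masks F n k t m) :
    S.queriesTo T K (Z + d) = S.queriesTo T K Z +
      fun r => (d r * diag2 S.GD).submatrix id fun ps => (ps.1, (ps.2 : Fin n)) := by
  funext r
  ext ib ps
  simp only [queriesTo, query, Pi.add_apply, Matrix.add_mul, Matrix.submatrix_apply,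
    Matrix.add_apply]
  ring

/-- The masks act transitively on the queries to `t` servers. -/
theorem exists_mask {T : Finset (Fin n)} (hT : T.card ≤ t) (Q : QueriesTo F n k t m T) :
    ∃ d : Masks F n k t m,
      (fun r => (d r * diag2 S.GD).submatrix id fun ps => (ps.1, (ps.2 : Fin n))) = Q := by
  have h : ∀ r ib p, ∃ u : Fin t → F, ∀ s : T, Matrix.vecMul u S.GD s = Q r ib (p, s) := by
    intro r ib p
    -- The value `0` outside `T` is arbitrary.
    obtain ⟨x, hx, hxy⟩ := S.D_grs.exists_mem_eq_on hT
      fun s => if hs : s ∈ T then Q r ib (p, ⟨s, hs⟩) else 0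
    obtain ⟨u, rfl⟩ := S.GD_gen.exists_vecMul hx
    exact ⟨u, fun s => by simp [hxy s s.2]⟩
  choose u hu using h
  refine ⟨fun r => Matrix.of fun ib pi => u r ib pi.1 pi.2, ?_⟩
  funext r
  ext ib ⟨p, s⟩
  rw [Matrix.submatrix_apply, mul_diag2_apply, ← hu]
  rfl

/-- The shift `d` absorbs the difference of the constant terms at `Z = 0`. User privacy takes `Q =
0`; uniformity takes `K = K'`. -/
theorem exists_mask_translate {T : Finset (Fin n)} (hT : T.card ≤ t) (K K' : Fin m)
    (Q : QueriesTo F n k t m T) :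
    ∃ d : Masks F n k t m, ∀ Z, S.queriesTo T K' (Z + d) = S.queriesTo T K Z + Q := by
  obtain ⟨d, hd⟩ := S.exists_mask hT (S.queriesTo T K 0 - S.queriesTo T K' 0 + Q)
  refine ⟨d, fun Z => ?_⟩
  have h1 := S.queriesTo_add T K' 0 Z
  have h2 := S.queriesTo_add T K 0 Z
  rw [zero_add] at h1 h2
  rw [queriesTo_add, hd, h1, h2]
  abel

/-- The responses of `T` are determined by the queries to `T`. -/
theorem response_congr {T : Finset (Fin n)} {K K' : Fin m} {Z Z' : Masks F n k t m}
    (h : S.queriesTo T K Z = S.queriesTo T K' Z') (X : Files F n k t m)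
    (r : Fin (roundsParam n k t)) (p : Fin 2) {s : Fin n} (hs : s ∈ T) :
    S.response K X Z r (p, s) = S.response K' X Z' r (p, s) := by
  have hq : (S.query K Z r).col (p, s) = (S.query K' Z' r).col (p, s) := by
    funext ib
    exact congrFun (congrFun (congrFun h r) ib) (p, ⟨s, hs⟩)
  rw [response, response, hq]

/-- Files that agree in the desired rows have responses that differ by pairs of codewords of the
star product. -/
theorem response_sub_mem (K : Fin m) (Z : Masks F n k t m) {X X' : Files F n k t m}
    (h : ∀ b ps, X (K, b) ps = X' (K, b) ps) (r : Fin (roundsParam n k t)) (p : Fin 2) :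
    (fun s => S.response K X Z r (p, s) - S.response K X' Z r (p, s)) ∈
      starProduct S.C S.D := by
  have key : (fun s => S.response K X Z r (p, s) - S.response K X' Z r (p, s)) =
      ∑ ib, Matrix.vecMul (fun i => (X - X') ib (p, i)) S.GC *
        Matrix.vecMul (fun i => Z r ib (p, i)) S.GD := by
    funext s
    rw [Finset.sum_apply, response, response, ← sub_dotProduct, dotProduct]
    refine Finset.sum_congr rfl fun ib _ => ?_
    have hY : ((S.encoded X).col (p, s) - (S.encoded X').col (p, s)) ib =
        Matrix.vecMul (fun i => (X - X') ib (p, i)) S.GC s := by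
      rw [← mul_diag2_apply, Matrix.sub_mul]
      rfl
    have hQ : (S.query K Z r).col (p, s) ib = Matrix.vecMul (fun i => Z r ib (p, i)) S.GD s +
        Matrix.vecMul (fun i => S.fileSelector K r ib (p, i)) (S.unitRows r) s := by
      rw [← mul_diag2_apply, ← mul_diag2_apply]
      rfl
    rw [hY, hQ, Pi.mul_apply]
    obtain ⟨i, b⟩ := ib
    -- For the desired file the difference of the contents is zero; for any other file the selector
    -- is zero and the query row is a codeword of `D`.
    by_cases hi : i = K
    · subst hi
      have hz : (fun j => (X - X') (i, b) (p, j)) = 0 := by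
        funext j; simp [h]
      rw [hz, Matrix.zero_vecMul]
      simp
    · have hz : (fun j => S.fileSelector K r (i, b) (p, j)) = 0 := by
        funext j; simp [fileSelector, hi]
      rw [hz, Matrix.zero_vecMul]
      simp
  rw [key]
  exact Submodule.sum_mem _ fun ib _ => Submodule.subset_span
    ⟨_, S.GC_gen.vecMul_mem _, _, S.GD_gen.vecMul_mem _, rfl⟩

theorem stabilizerSpace_mem_dualCode {v : Fin 2 × Fin n → F} (hv : v ∈ S.stabilizerSpace)
    (p : Fin 2) : (fun s => v (p, s)) ∈ dualCode (starProduct S.C S.D) := by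
  induction hv using Submodule.span_induction with
  | mem x hx =>
    obtain ⟨⟨p', i⟩, rfl⟩ := hx
    by_cases hp : p' = p
    · have : (fun s => (diag2 S.HS).row (p', i) (p, s)) = S.HS.row i := by
        funext s; simp [diag2, hp]
      rw [this, ← S.HS_gen.2]
      exact Submodule.subset_span ⟨i, rfl⟩
    · have : (fun s => (diag2 S.HS).row (p', i) (p, s)) = 0 := by
        funext s; simp [diag2, hp]
      rw [this]
      exact Submodule.zero_mem _
  | zero => exact Submodule.zero_mem _
  | add x y _ _ hx hy => exact Submodule.add_mem _ hx hy
  | smul a x _ hx => exact Submodule.smul_mem _ a hx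

/-- The form pairs each half of `v` with the opposite half of `d`, and each pairing vanishes by
duality. -/
theorem sympForm_stabilizerSpace {v d : Fin 2 × Fin n → F} (hv : v ∈ S.stabilizerSpace)
    (hd : ∀ p, (fun s => d (p, s)) ∈ starProduct S.C S.D) : sympForm v d = 0 := by
  have h0 : ∑ s, d (0, s) * v (1, s) = 0 := S.stabilizerSpace_mem_dualCode hv 1 _ (hd 0)
  have h1 : ∑ s, d (1, s) * v (0, s) = 0 := S.stabilizerSpace_mem_dualCode hv 0 _ (hd 1)
  rw [sympForm, Finset.sum_sub_distrib]
  simp only [mul_comm (v _), h0, h1, sub_zero]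

/-! ### User privacy, server privacy and uniform queries. -/

variable [Fintype F] [DecidableEq F]

theorem userPrivate (m : ℕ) : S.UserPrivate m := by
  intro T hT U X K K'
  funext Q
  obtain ⟨d, hd⟩ := S.exists_mask_translate hT K K' 0
  -- After the shift by `d` in the sum for `K'`, the two sums agree term by term.
  rw [serverView, serverView, ← Equiv.sum_comp (Equiv.addRight d)
    fun Z => if S.queriesTo T K' Z = Q then _ else _]
  refine Finset.sum_congr rfl fun Z _ => ?_
  have hQ : S.queriesTo T K' (Z + d) = S.queriesTo T K Z := by rw [hd, add_zero]
  have hρ : ∀ r, reducedState T (S.roundState (U r) K X Z r) =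
      reducedState T (S.roundState (U r) K' X (Z + d) r) := by
    intro r
    refine reducedState_conj_weyl_congr T _ _ (fun p s hs => ?_) _
    simp only [S.response_congr hQ X r p hs]
  simp only [Equiv.coe_addRight, hQ, hρ]

theorem serverPrivate (m : ℕ) : S.ServerPrivate m := by
  intro K Z X X' h
  refine congrArg tensor (funext fun r => ?_)
  simp only [roundState, Finset.mem_univ, if_true]
  have hA : (fun ps => S.response K X Z r ps) = (fun ps => S.response K X' Z r ps) +
      fun ps => S.response K X Z r ps - S.response K X' Z r ps := by
    funext ps; simp
  rw [hA, conj_weyl_add]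
  rw [initialState, Matrix.mul_smul (weyl _) _ (eigenProj _ _), Matrix.smul_mul,
    conj_weyl_eigenProj]
  exact fun v hv => S.sympForm_stabilizerSpace hv fun p => S.response_sub_mem K Z h r p

end Scheme

theorem _root_.PMF.eq_uniformOfFintype_of_const {α : Type*} [Fintype α] [Nonempty α] (p : PMF α)
    (h : ∀ a b, p a = p b) : p = PMF.uniformOfFintype α := by
  ext a
  have hs : ∑ b, p b = 1 := by rw [← tsum_fintype (L := .unconditional α), p.tsum_coe]
  rw [Finset.sum_congr rfl fun b _ => h b a, Finset.sum_const, Finset.card_univ,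
    nsmul_eq_mul] at hs
  rw [PMF.uniformOfFintype_apply]
  exact ENNReal.eq_inv_of_mul_eq_one_left (by rwa [mul_comm])

theorem Scheme.queryLaw_eq_uniform {F : Type*} [Field F] [Fintype F] [DecidableEq F]
    {n k t m : ℕ} (S : Scheme F n k t) {T : Finset (Fin n)} (hT : T.card ≤ t) (K : Fin m) :
    S.queryLaw T K = PMF.uniformOfFintype (QueriesTo F n k t m T) := by
  refine PMF.eq_uniformOfFintype_of_const _ fun Q Q' => ?_
  obtain ⟨d, hd⟩ := S.exists_mask_translate hT K K (Q' - Q)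
  simp only [queryLaw, PMF.map_apply, tsum_fintype]
  -- Translation by `d` carries the masks producing `Q` bijectively to those producing `Q'`.
  refine Fintype.sum_equiv (Equiv.addRight d) _ _ fun Z => ?_
  have hiff : Q' = S.queriesTo T K (Z + d) ↔ Q = S.queriesTo T K Z := by
    rw [hd]
    constructor <;> intro h
    · have := congrArg (· - (Q' - Q)) h
      simpa using this
    · rw [← h]; abel
  simp only [Equiv.coe_addRight, hiff, PMF.uniformOfFintype_apply]

end StarQPIR

theorem mainTheorem3 {F : Type*} [Field F] [Fintype F] [DecidableEq F] {n k t : ℕ}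
    (S : StarQPIR.Scheme F n k t) (m : ℕ) :
    S.Symmetric m ∧
      ∀ T : Finset (Fin n), T.card ≤ t → ∀ K : Fin m,
        S.queryLaw T K = PMF.uniformOfFintype (StarQPIR.QueriesTo F n k t m T) := by
  exact ⟨⟨S.userPrivate m, S.serverPrivate m⟩, fun _ hT K => S.queryLaw_eq_uniform hT K⟩
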